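/- Let $\mathcal E$ be a finite set of basic events, $\Omega=\{0,1\}^{\mathcal E}$ the set of states, and call the subsets of $\Omega$ events; each event is a Boolean combination of basic events. Formulas of past-time temporal logic $\mathrm{TL}$ are built from basic events and $\mathit{true}$ by $\lnot,\lor,\bullet$ (previously) and $\mathsf S$ (since), and are interpreted at the positions of nonempty finite words over $\Omega$; $\Diamond\varphi$ ("once $\varphi$") is $\mathit{true}\,\mathsf S\,\varphi$. For $\varphi,\psi\in\mathrm{TL}$, the conditional $(\varphi|\psi)$ is the function $c:\Omega^+\to\{0,1,\bot\}$ whose value on a word is, at its last position, $1$ if $\varphi\land\psi$ holds, $0$ if $\lnot\varphi\land\psi$ holds, and $\bot$ (undefined) if $\psi$ fails. Given a probability measure $\Pr$ on $\Omega$, put the product measure on $\Omega^\infty$ and let $c_n(w)$ be the value of $c$ on the prefix of $w$ of length $n$. The asymptotic probability of $c$ is $\Pr(c)=\lim_{n\to\infty}\Pr(c_n=1)/\Pr(c_n\in\{0,1\})$, provided that the denominator is nonzero for all large $n$ and the limit exists. Conditional expressions are built from simple conditionals $(a|b)$, with $a,b$ events, by $\land,\lor,\sim$. The product space semantics is $[\![(a|b)]\!]=\bigcup_{j\ge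 0}(\Omega\setminus b)^j\times(b\cap a)\times\Omega\times\Omega\times\cdots\subseteq\Omega^\infty$, with $\land,\lor,\sim$ interpreted as intersection, union and complement, and $\Pr_o(e)$ is the product measure of $[\![e]\!]$. Let $e$ be an expression whose simple conditionals are $(a_1|b_1),\dots,(a_m|b_m)$. Let $e^{F}$ and $e^{R}$ be the $\mathrm{TL}$ formulas obtained from $e$ by replacing each $(a_i|b_i)$ by $\Diamond(a_i\land b_i\land\lnot\bullet\Diamond b_i)$ and by $(\lnot b_i)\,\mathsf S\,(a_i\land b_i)$, respectively, and reading $\land,\lor,\sim$ as the Boolean connectives. The first embedding of $e$ is $(e^F|\mathit{true})$, and the sparse reverse interpretation of $e$ is $$e^{S}=\Bigl(e^{R}\,\Big|\,\bigvee_{i=1}^m(b_i\lor\lnot\Diamond b_i)\Bigr).$$ Theorem. (1) For every conditional expression $e$ and every probability measure $\Pr$ on $\Omega$, the asymptotic probabilities of $e^S$ and of $(e^F|\mathit{true})$ exist, and $\Pr(e^S)=\Pr_o(e)=\Pr((e^F|\mathit{true}))$. (2) If $\Pr(b_i)>0$ for all $i$, then $\lim_{n\to\infty}\Pr(e^S_n=\bot)=1-\Pr(b_1\cup\dots\cup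 b_m)$. If $\mathcal E\neq\varnothing$, there are $\Pr$ and $e$ for which $\lim_{n\to\infty}\Pr(e^S_n=\bot)$ exists and is positive. (3) The interpretation $e\mapsto e^S$ is not an embedding: for distinct basic events $a,b$ we have $[\![(\varnothing|a)]\!]=[\![(\varnothing|b)]\!]$, but $(\varnothing|a)^S\ne(\varnothing|b)^S$ as functions on $\Omega^+$. -/

import Mathlib

open MeasureTheory Filter Topology

namespace CondTL

/-- A state assigns a truth value to every basic event. The states are the atoms of the Boolean
algebra generated by the basic events, and the events are the sets of states. -/
abbrev State (E : Type*) := E → Bool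

/-- The event named by a basic event. -/
def basic {E : Type*} (x : E) : Set (State E) := {ω | ω x = true}

/-- Formulas of temporal logic of linear discrete past time. -/
inductive TL (E : Type*) where
  | verum : TL E
  | atom : E → TL E
  | neg : TL E → TL E
  | or : TL E → TL E → TL E
  | prev : TL E → TL E
  | since : TL E → TL E → TL E

namespace TL

variable {E : Type*}

def and (φ ψ : TL E) : TL E := neg (or (neg φ) (neg ψ))

/-- "Once `φ`": `true Since φ`. -/
def once (φ : TL E) : TL E := since verum φ

def bigOr (l : List (TL E)) : TL E := l.foldr or (neg verum)

def bigAnd (l : List (TL E)) : TL E := l.foldr and verum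

/-- `M, s ⊨ φ` for a model `M = s_0, …, s_n`. -/
def Sat {n : ℕ} (M : Fin (n + 1) → State E) : TL E → Fin (n + 1) → Prop
  | verum, _ => True
  | atom x, s => M s x = true
  | neg φ, s => ¬ Sat M φ s
  | or φ ψ, s => Sat M φ s ∨ Sat M ψ s
  | prev φ, s => ∃ t : Fin (n + 1), (t : ℕ) + 1 = s ∧ Sat M φ t
  | since φ ψ, s => ∃ t ≤ s, Sat M ψ t ∧ ∀ u, t < u → u ≤ s → Sat M φ u

/-- The conjunction of literals that describes one state. -/
noncomputable def ofState [Fintype E] (ω : State E) : TL E :=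
  bigAnd (Finset.univ.toList.map fun x => if ω x then atom x else neg (atom x))

/-- An event as a Boolean combination of basic events (full disjunctive normal form). -/
noncomputable def ofEvent [Fintype E] (a : Set (State E)) : TL E :=
  bigOr ((Set.toFinite a).toFinset.toList.map ofState)

theorem sat_and {n : ℕ} (M : Fin (n + 1) → State E) (φ ψ : TL E) (s : Fin (n + 1)) :
    Sat M (and φ ψ) s ↔ Sat M φ s ∧ Sat M ψ s := by
  simp [and, Sat]

theorem sat_bigOr {n : ℕ} (M : Fin (n + 1) → State E) (l : List (TL E)) (s : Fin (n + 1)) :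
    Sat M (bigOr l) s ↔ ∃ φ ∈ l, Sat M φ s := by
  induction l with
  | nil => simp [bigOr, Sat]
  | cons φ l ih =>
    have h : Sat M (bigOr (φ :: l)) s ↔ Sat M φ s ∨ Sat M (bigOr l) s := Iff.rfl
    rw [h, ih]; simp

theorem sat_bigAnd {n : ℕ} (M : Fin (n + 1) → State E) (l : List (TL E)) (s : Fin (n + 1)) :
    Sat M (bigAnd l) s ↔ ∀ φ ∈ l, Sat M φ s := by
  induction l with
  | nil => simp [bigAnd, Sat]
  | cons φ l ih =>
    have h : Sat M (bigAnd (φ :: l)) s ↔ Sat M φ s ∧ Sat M (bigAnd l) s := sat_and _ _ _ _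
    rw [h, ih]; simp

theorem sat_ofState [Fintype E] {n : ℕ} (M : Fin (n + 1) → State E) (ω : State E)
    (s : Fin (n + 1)) : Sat M (ofState ω) s ↔ M s = ω := by
  rw [ofState, sat_bigAnd, funext_iff]
  simp only [List.mem_map, Finset.mem_toList, Finset.mem_univ, true_and,
    forall_exists_index, forall_apply_eq_imp_iff]
  refine forall_congr' fun x => ?_
  cases h : ω x <;> simp [Sat]

theorem sat_ofEvent [Fintype E] {n : ℕ} (M : Fin (n + 1) → State E) (a : Set (State E))
    (s : Fin (n + 1)) : Sat M (ofEvent a) s ↔ M s ∈ a := by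
  rw [ofEvent, sat_bigOr]
  simp [sat_ofState]

end TL

/-- The truth values `0`, `1` and "undefined". -/
inductive Three where
  | zero
  | one
  | undef

/-- Nonempty finite words over the alphabet of states; `⟨n, w⟩` has length `n + 1`. -/
abbrev Word (E : Type*) := (n : ℕ) × (Fin (n + 1) → State E)

/-- A conditional formula `(φ | ψ)` with temporal formulas `φ`, `ψ`. -/
structure TLTL (E : Type*) where
  concl : TL E
  given : TL E

/-- The conditional object (three-valued function on words) defined by `(φ | ψ)`, evaluated at
the last state of the word. -/
noncomputable def TLTL.obj {E : Type*} (c : TLTL E) : Word E → Three :=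
  open Classical in fun w =>
    if c.given.Sat w.2 (Fin.last w.1) then
      if c.concl.Sat w.2 (Fin.last w.1) then Three.one else Three.zero
    else Three.undef

/-- Flat conditional expressions, built from simple conditionals `(a | b)` of events. -/
inductive CExpr (E : Type*) where
  | simple : Set (State E) → Set (State E) → CExpr E
  | and : CExpr E → CExpr E → CExpr E
  | or : CExpr E → CExpr E → CExpr E
  | neg : CExpr E → CExpr E

namespace CExpr

variable {E : Type*}

/-- The conditions `b_1, …, b_m` of the simple conditionals `(a_i | b_i)` occurring in `e`. -/
def conditions : CExpr E → List (Set (State E))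
  | simple _ b => [b]
  | and e e' => e.conditions ++ e'.conditions
  | or e e' => e.conditions ++ e'.conditions
  | neg e => e.conditions

/-- The product space semantics. -/
def ps : CExpr E → Set (ℕ → State E)
  | simple a b => ⋃ j : ℕ, {w | (∀ i < j, w i ∈ bᶜ) ∧ w j ∈ b ∩ a}
  | and e e' => e.ps ∩ e'.ps
  | or e e' => e.ps ∪ e'.ps
  | neg e => (e.ps)ᶜ

variable [Fintype E]

/-- Temporal part of the first embedding: `(a | b)` becomes `◇(a ∧ b ∧ ¬ prev ◇ b)`. -/
noncomputable def firstTL : CExpr E → TL E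
  | simple a b => TL.once (TL.and (TL.ofEvent a)
      (TL.and (TL.ofEvent b) (TL.neg (TL.prev (TL.once (TL.ofEvent b))))))
  | and e e' => TL.and e.firstTL e'.firstTL
  | or e e' => TL.or e.firstTL e'.firstTL
  | neg e => TL.neg e.firstTL

/-- The first embedding. -/
noncomputable def first (e : CExpr E) : TLTL E := ⟨e.firstTL, TL.verum⟩

/-- Temporal part of the reverse embedding: `(a | b)` becomes `bᶜ Since (a ∧ b)`. -/
noncomputable def revTL : CExpr E → TL E
  | simple a b => TL.since (TL.ofEvent bᶜ) (TL.and (TL.ofEvent a) (TL.ofEvent b))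
  | and e e' => TL.and e.revTL e'.revTL
  | or e e' => TL.or e.revTL e'.revTL
  | neg e => TL.neg e.revTL

/-- The sparse reverse interpretation: the reverse formula of `e` given `⋁ᵢ (bᵢ ∨ ¬ ◇ bᵢ)`. -/
noncomputable def sparse (e : CExpr E) : TLTL E :=
  ⟨e.revTL, TL.bigOr (e.conditions.map fun b =>
    TL.or (TL.ofEvent b) (TL.neg (TL.once (TL.ofEvent b))))⟩

end CExpr

variable {E : Type*}

/-- The product measure on infinite sequences of states. -/
noncomputable def seqMeasure (P : Measure (State E)) [IsProbabilityMeasure P] :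
    Measure (ℕ → State E) :=
  Measure.infinitePi fun _ : ℕ => P

/-- The value of the conditional object `c` on the prefix of length `n + 1`. -/
def valueAt (c : Word E → Three) (n : ℕ) (w : ℕ → State E) : Three :=
  c ⟨n, fun i => w i⟩

/-- The probability that `c` takes the value `v` on the prefix of length `n + 1`. -/
noncomputable def probAt (P : Measure (State E)) [IsProbabilityMeasure P]
    (c : Word E → Three) (n : ℕ) (v : Three) : ℝ :=
  (seqMeasure P).real {w | valueAt c n w = v}

/-- The probability that `c` is defined on the prefix of length `n + 1`. -/
noncomputable def probDefinedAt (P : Measure (State E)) [IsProbabilityMeasure P]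
    (c : Word E → Three) (n : ℕ) : ℝ :=
  (seqMeasure P).real {w | valueAt c n w = Three.zero ∨ valueAt c n w = Three.one}

/-- The asymptotic probability of `c` exists and equals `p`. -/
def HasAsympProb (P : Measure (State E)) [IsProbabilityMeasure P]
    (c : Word E → Three) (p : ℝ) : Prop :=
  (∀ᶠ n in atTop, probDefinedAt P c n ≠ 0) ∧
    Tendsto (fun n => probAt P c n Three.one / probDefinedAt P c n) atTop (𝓝 p)

/-- The probability of an expression in the product space conditional event algebra. -/
noncomputable def prPS (P : Measure (State E)) [IsProbabilityMeasure P] (e : CExpr E) : ℝ :=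
  (seqMeasure P).real e.ps

end CondTL

/-! The last state of a prefix of independent, identically distributed states may be moved to the
front: reversing prefixes preserves the product measure and turns `bᶜ Since (a ∧ b)` into
`◇(a ∧ b ∧ ¬ prev ◇ b)`, whose truth on longer and longer prefixes stabilizes to membership in the
product space semantics. The condition `⋁ᵢ (bᵢ ∨ ¬ ◇ bᵢ)` likewise stabilizes, after reversal, to
"some `bᵢ` holds at the first state or never".

If some `bᵢ` is null, the latter has probability one. Otherwise each `bᵢ` occurs almost surely, so
what remains is that the first state lies in `⋃ᵢ bᵢ`. As long as it does not, it has no influence on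
the value of the expression and can be dropped; hence the value of the expression is independent of
this event, and conditioning on it changes nothing. -/

namespace CondTL

open ProbabilityTheory

/-! ### Probability -/

theorem eventually_exists_le_iff {α : Type*} [Preorder α] (p : α → Prop) :
    ∀ᶠ n in atTop, ((∃ i ≤ n, p i) ↔ ∃ i, p i) := by
  by_cases h : ∃ i, p i
  · obtain ⟨i, hi⟩ := h
    filter_upwards [eventually_ge_atTop i] with n hn
    exact iff_of_true ⟨i, hn, hi⟩ ⟨i, hi⟩
  · exact .of_forall fun n => iff_of_false (fun ⟨i, _, hi⟩ => h ⟨i, hi⟩) h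

theorem tendsto_measureReal_of_measurePreserving {ι α β : Type*} [MeasurableSpace α]
    [MeasurableSpace β] {μ : Measure α} {ν : Measure β} [IsFiniteMeasure μ] {l : Filter ι}
    [l.IsCountablyGenerated] {σ : ι → α → β} (hσ : ∀ i, MeasurePreserving (σ i) μ ν)
    {s : ι → Set β} (hs : ∀ i, MeasurableSet (s i)) {t : Set α}
    (h : ∀ x, ∀ᶠ i in l, (σ i x ∈ s i ↔ x ∈ t)) :
    Tendsto (fun i => ν.real (s i)) l (𝓝 (μ.real t)) := by
  have hlim : Tendsto (fun i => μ (σ i ⁻¹' s i)) l (𝓝 (μ t)) :=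
    tendsto_measure_of_tendsto_indicator_of_isFiniteMeasure l μ
      (fun i => (hσ i).measurable (hs i)) h
  simp only [(hσ _).measure_preimage (hs _).nullMeasurableSet] at hlim
  exact (ENNReal.tendsto_toReal (measure_ne_top μ t)).comp hlim

theorem indepSet_of_indepSet_compl_right {α : Type*} [MeasurableSpace α] {μ : Measure α}
    {s t : Set α} (h : IndepSet s tᶜ μ) : IndepSet s t μ := by
  refine indep_of_indep_of_le_right h (MeasurableSpace.generateFrom_le ?_)
  rintro _ rfl
  exact MeasurableSet.of_compl (MeasurableSpace.measurableSet_generateFrom (Set.mem_singleton _))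

theorem indepFun_reindex_of_notMem_range {α ι κ : Type*} [MeasurableSpace α] {μ : Measure α}
    {β : ι → Type*} [∀ i, MeasurableSpace (β i)] {X : ∀ i, α → β i} (hX : ∀ i, Measurable (X i))
    (hindep : iIndepFun X μ) {i : ι} {f : κ → ι} (hi : i ∉ Set.range f) :
    IndepFun (X i) (fun x k => X (f k) x) μ := by
  have hdisj : Disjoint {i} (Set.range f) := Set.disjoint_singleton_left.2 hi
  have hsup := indep_iSup_of_disjoint (fun i => (hX i).comap_le) hindep hdisj
  refine indep_of_indep_of_le hsup (le_iSup₂_of_le i rfl le_rfl) ?_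
  simp only [MeasurableSpace.pi, MeasurableSpace.comap_iSup, MeasurableSpace.comap_comp]
  exact iSup_le fun k => le_iSup₂_of_le (f k) ⟨k, rfl⟩ le_rfl

section InfinitePi

variable {Ω : Type*} [MeasurableSpace Ω] (P : Measure Ω) [IsProbabilityMeasure P]

theorem measurePreserving_reindex_infinitePi {ι κ : Type*} {f : κ → ι} (hf : f.Injective) :
    MeasurePreserving (fun (w : ι → Ω) k => w (f k)) (Measure.infinitePi fun _ => P)
      (Measure.infinitePi fun _ => P) where
  measurable := by fun_prop
  map_eq := Measure.map_infinitePi_infinitePi_of_inj hf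

/-- Off `B`, the set `N` looks at the tail only, and the tail is distributed like the whole
sequence and independent of the first term. -/
theorem indepSet_infinitePi_of_mem_iff_tail {B : Set Ω} (hB : MeasurableSet B) {N : Set (ℕ → Ω)}
    (hN : MeasurableSet N) (htail : ∀ w, w 0 ∉ B → (w ∈ N ↔ (fun i => w (i + 1)) ∈ N)) :
    IndepSet N {w | w 0 ∈ B} (Measure.infinitePi fun _ => P) := by
  have hhead : MeasurableSet {w : ℕ → Ω | w 0 ∈ B} := measurable_pi_apply 0 hB
  have hshift := measurePreserving_reindex_infinitePi P (add_left_injective 1)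
  have hindep : IndepFun (fun w : ℕ → Ω => w 0) (fun w i => w (i + 1))
      (Measure.infinitePi fun _ => P) :=
    indepFun_reindex_of_notMem_range measurable_pi_apply
      (iIndepFun_infinitePi (X := fun _ => id) fun _ => measurable_id) (by simp)
  have hinter : N ∩ {w | w 0 ∈ B}ᶜ =
      (fun w : ℕ → Ω => w 0) ⁻¹' Bᶜ ∩ (fun w i => w (i + 1)) ⁻¹' N := by
    ext w
    exact and_comm.trans (and_congr_right (htail w))
  apply indepSet_of_indepSet_compl_right
  refine (indepSet_iff_measure_inter_eq_mul hN hhead.compl _).2 ?_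
  rw [hinter, hindep.measure_inter_preimage_eq_mul _ _ hB.compl hN,
    hshift.measure_preimage hN.nullMeasurableSet, mul_comm]
  rfl

theorem infinitePi_ae_exists_mem {B : Set Ω} (hB : MeasurableSet B) (hpos : P B ≠ 0) :
    ∀ᵐ w ∂Measure.infinitePi fun _ : ℕ => P, ∃ i, w i ∈ B := by
  set N : Set (ℕ → Ω) := {w | ∀ i, w i ∉ B}
  have hcoord (i : ℕ) : MeasurableSet {w : ℕ → Ω | w i ∉ B} :=
    (measurable_pi_apply i hB).compl
  have hN : MeasurableSet N := measurableSet_setOfPred.2 <|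
    .forall fun i => measurableSet_setOfPred.1 (hcoord i)
  have hindep : IndepSet N {w | w 0 ∈ B} (Measure.infinitePi fun _ => P) :=
    indepSet_infinitePi_of_mem_iff_tail P hB hN fun w hw =>
      ⟨fun h i => h (i + 1), fun h i => by cases i; exacts [hw, h _]⟩
  have hinter : N ∩ {w | w 0 ∈ B} = ∅ := Set.eq_empty_of_forall_notMem fun w hw => hw.1 0 hw.2
  have hmul := hindep.measure_inter_eq_mul
  have heval := (measurePreserving_eval_infinitePi (fun _ : ℕ => P) 0).measure_preimage
    hB.nullMeasurableSet
  rw [hinter, measure_empty, eq_comm, mul_eq_zero] at hmul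
  rw [ae_iff]
  simpa only [not_exists] using hmul.resolve_right (heval.trans_ne hpos)

theorem infinitePi_ae_forall_notMem {ι : Type*} [Countable ι] {B : Set Ω} (h0 : P B = 0) :
    ∀ᵐ w ∂Measure.infinitePi fun _ : ι => P, ∀ i, w i ∉ B :=
  ae_all_iff.2 fun i => (measurePreserving_eval_infinitePi _ i).quasiMeasurePreserving.ae
    (measure_eq_zero_iff_ae_notMem.1 h0)

end InfinitePi

/-! ### Prefixes of sequences of states -/

variable {E : Type*}

/-- The reversal of the first `n + 1` positions, fixing all later ones. -/
def reversal (n : ℕ) : Equiv.Perm ℕ :=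
  Equiv.Perm.extendDomain (Fin.revPerm (n := n + 1)) Fin.equivSubtype

theorem reversal_val {n : ℕ} (i : Fin (n + 1)) : reversal n i = i.rev :=
  Equiv.Perm.extendDomain_apply_image Fin.revPerm Fin.equivSubtype i

instance isProbabilityMeasure_seqMeasure (P : Measure (State E)) [IsProbabilityMeasure P] :
    IsProbabilityMeasure (seqMeasure P) :=
  inferInstanceAs (IsProbabilityMeasure (Measure.infinitePi _))

theorem measurePreserving_reversal (P : Measure (State E)) [IsProbabilityMeasure P] (n : ℕ) :
    MeasurePreserving (fun w i => w (reversal n i)) (seqMeasure P) (seqMeasure P) :=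
  measurePreserving_reindex_infinitePi P (reversal n).injective

namespace TL

theorem sat_neg {n : ℕ} (M : Fin (n + 1) → State E) (φ : TL E) (s : Fin (n + 1)) :
    Sat M (neg φ) s ↔ ¬ Sat M φ s :=
  Iff.rfl

theorem sat_once {n : ℕ} (M : Fin (n + 1) → State E) (φ : TL E) (s : Fin (n + 1)) :
    Sat M (once φ) s ↔ ∃ t ≤ s, Sat M φ t := by
  simp [once, Sat]

theorem sat_prev_once {n : ℕ} (M : Fin (n + 1) → State E) (φ : TL E) (s : Fin (n + 1)) :
    Sat M (prev (once φ)) s ↔ ∃ t < s, Sat M φ t := by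
  simp only [Sat, sat_once]
  constructor
  · rintro ⟨s', hs', t, ht, hφ⟩
    exact ⟨t, by omega, hφ⟩
  · rintro ⟨t, ht, hφ⟩
    exact ⟨⟨s - 1, by omega⟩, by simp only; omega, t, Fin.le_def.2 (by simp only; omega), hφ⟩

theorem measurable_sat (φ : TL E) {n : ℕ} (s : Fin (n + 1)) :
    Measurable fun M : Fin (n + 1) → State E => Sat M φ s := by
  induction φ generalizing s with
  | verum => exact measurable_const
  | atom x =>
    have heval : Measurable fun M : Fin (n + 1) → State E => M s x := by fun_prop
    exact measurableSet_setOfPred.1 (heval (measurableSet_singleton true))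
  | neg φ ih => exact (ih s).not
  | or φ ψ ihφ ihψ => exact (ihφ s).or (ihψ s)
  | prev φ ih => exact .exists fun t => measurable_const.and (ih t)
  | since φ ψ ihφ ihψ =>
    exact .exists fun t => measurable_const.and <| (ihψ t).and <|
      .forall fun u => measurable_const.imp <| measurable_const.imp (ihφ u)

/-- The sequences whose prefix of length `n + 1` satisfies `φ` at its last position. -/
def prefixModels (φ : TL E) (n : ℕ) : Set (ℕ → State E) :=
  {w | φ.Sat (fun i : Fin (n + 1) => w i) (Fin.last n)}

theorem measurableSet_prefixModels (φ : TL E) (n : ℕ) : MeasurableSet (φ.prefixModels n) := by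
  have hprefix : Measurable fun (w : ℕ → State E) (i : Fin (n + 1)) => w i := by fun_prop
  exact hprefix (measurableSet_setOfPred.2 (φ.measurable_sat (Fin.last n)))

theorem reversal_mem_prefixModels {φ : TL E} {n : ℕ} {w : ℕ → State E} :
    (fun i => w (reversal n i)) ∈ φ.prefixModels n ↔
      φ.Sat (fun i : Fin (n + 1) => w i.rev) (Fin.last n) := by
  simp only [prefixModels, Set.mem_ofPred_eq, reversal_val]

end TL

namespace TLTL

variable (c : TLTL E) (n : ℕ) (w : ℕ → State E)

theorem valueAt_obj_eq_one_iff :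
    valueAt c.obj n w = Three.one ↔ w ∈ c.concl.prefixModels n ∩ c.given.prefixModels n := by
  simp only [valueAt, obj, TL.prefixModels, Set.mem_inter_iff, Set.mem_ofPred_eq]
  split_ifs <;> simp [*]

theorem valueAt_obj_eq_undef_iff :
    valueAt c.obj n w = Three.undef ↔ w ∉ c.given.prefixModels n := by
  simp only [valueAt, obj, TL.prefixModels, Set.mem_ofPred_eq]
  split_ifs <;> simp [*]

theorem valueAt_obj_defined_iff :
    valueAt c.obj n w = Three.zero ∨ valueAt c.obj n w = Three.one ↔
      w ∈ c.given.prefixModels n := by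
  simp only [valueAt, obj, TL.prefixModels, Set.mem_ofPred_eq]
  split_ifs <;> simp [*]

end TLTL

section Asymptotics

variable {P : Measure (State E)} [IsProbabilityMeasure P] {c : TLTL E}
  {σ : ℕ → (ℕ → State E) → ℕ → State E}
  (hσ : ∀ n, MeasurePreserving (σ n) (seqMeasure P) (seqMeasure P)) {S D : Set (ℕ → State E)}
  (hD : ∀ w, ∀ᶠ n in atTop, (σ n w ∈ c.given.prefixModels n ↔ w ∈ D))

include hσ hD

theorem tendsto_probDefinedAt :
    Tendsto (fun n => probDefinedAt P c.obj n) atTop (𝓝 ((seqMeasure P).real D)) := by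
  simp only [probDefinedAt, TLTL.valueAt_obj_defined_iff]
  exact tendsto_measureReal_of_measurePreserving hσ c.given.measurableSet_prefixModels hD

theorem tendsto_probAt_undef :
    Tendsto (fun n => probAt P c.obj n Three.undef) atTop (𝓝 (1 - (seqMeasure P).real D)) := by
  have hcompl (n : ℕ) : probAt P c.obj n Three.undef = 1 - probDefinedAt P c.obj n := by
    simp only [probAt, probDefinedAt, TLTL.valueAt_obj_eq_undef_iff, TLTL.valueAt_obj_defined_iff]
    exact probReal_compl_eq_one_sub (c.given.measurableSet_prefixModels n)
  simp only [hcompl]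
  exact (tendsto_probDefinedAt hσ hD).const_sub 1

theorem hasAsympProb_of_eventually_mem_iff
    (hS : ∀ w, ∀ᶠ n in atTop, (σ n w ∈ c.concl.prefixModels n ↔ w ∈ S))
    (hne : (seqMeasure P).real D ≠ 0) :
    HasAsympProb P c.obj ((seqMeasure P).real (S ∩ D) / (seqMeasure P).real D) := by
  have hden := tendsto_probDefinedAt hσ hD
  have hnum : Tendsto (fun n => probAt P c.obj n Three.one) atTop
      (𝓝 ((seqMeasure P).real (S ∩ D))) := by
    simp only [probAt, TLTL.valueAt_obj_eq_one_iff]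
    refine tendsto_measureReal_of_measurePreserving hσ (fun n =>
      (c.concl.measurableSet_prefixModels n).inter (c.given.measurableSet_prefixModels n))
      fun w => ?_
    filter_upwards [hS w, hD w] with n hSn hDn
    exact and_congr hSn hDn
  exact ⟨hden.eventually_ne hne, hnum.div hden hne⟩

end Asymptotics

/-! ### Conditional expressions -/

namespace CExpr

theorem conditions_ne_nil (e : CExpr E) : e.conditions ≠ [] := by
  induction e <;> simp_all [conditions]

theorem mem_ps_simple {a b : Set (State E)} {w : ℕ → State E} :
    w ∈ (simple a b).ps ↔ ∃ j, (∀ i < j, w i ∉ b) ∧ w j ∈ b ∩ a :=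
  Set.mem_iUnion

theorem mem_ps_iff_tail {e : CExpr E} {w : ℕ → State E} (h : ∀ b ∈ e.conditions, w 0 ∉ b) :
    w ∈ e.ps ↔ (fun i => w (i + 1)) ∈ e.ps := by
  induction e with
  | simple a b =>
    have hb : w 0 ∉ b := h b List.mem_cons_self
    simp only [mem_ps_simple]
    constructor
    · rintro ⟨_ | j, hlt, hj⟩
      · exact absurd hj.1 hb
      · exact ⟨j, fun i hi => hlt (i + 1) (by omega), hj⟩
    · rintro ⟨j, hlt, hj⟩
      refine ⟨j + 1, fun i hi => ?_, hj⟩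
      cases i with
      | zero => exact hb
      | succ i => exact hlt i (by omega)
  | and e e' ih ih' =>
    obtain ⟨h, h'⟩ := List.forall_mem_append.1 h
    exact and_congr (ih h) (ih' h')
  | or e e' ih ih' =>
    obtain ⟨h, h'⟩ := List.forall_mem_append.1 h
    exact or_congr (ih h) (ih' h')
  | neg e ih => exact not_congr (ih h)

/-- The sequences on which some condition of `e` holds at the first state or at no state: the limit
of the sets of sequences whose reversed prefix makes `e.sparse` defined. -/
def decided (e : CExpr E) : Set (ℕ → State E) :=
  {w | ∃ b ∈ e.conditions, w 0 ∈ b ∨ ∀ i, w i ∉ b}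

section Formulas

variable [Fintype E]

theorem sat_firstTL_simple {n : ℕ} (M : Fin (n + 1) → State E) (a b : Set (State E))
    (s : Fin (n + 1)) :
    (simple a b).firstTL.Sat M s ↔ ∃ t ≤ s, (∀ u < t, M u ∉ b) ∧ M t ∈ b ∩ a := by
  simp only [firstTL, TL.sat_once, TL.sat_and, TL.sat_ofEvent, TL.sat_neg, TL.sat_prev_once,
    not_exists, not_and, Set.mem_inter_iff]
  exact exists_congr fun t => and_congr_right fun _ => by tauto

theorem sat_revTL_simple {n : ℕ} (M : Fin (n + 1) → State E) (a b : Set (State E))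
    (s : Fin (n + 1)) :
    (simple a b).revTL.Sat M s ↔ ∃ t ≤ s, (∀ u, t < u → u ≤ s → M u ∉ b) ∧ M t ∈ b ∩ a := by
  simp only [revTL, TL.Sat, TL.sat_and, TL.sat_ofEvent, Set.mem_compl_iff, Set.mem_inter_iff]
  exact exists_congr fun t => and_congr_right fun _ => by tauto

theorem sat_revTL_last_iff_sat_firstTL_rev (e : CExpr E) {n : ℕ} (M : Fin (n + 1) → State E) :
    e.revTL.Sat M (Fin.last n) ↔ e.firstTL.Sat (fun i => M i.rev) (Fin.last n) := by
  induction e with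
  | simple a b =>
    rw [sat_revTL_simple, sat_firstTL_simple, Fin.rev_surjective.exists]
    simp only [Fin.le_last, true_and, forall_const]
    refine exists_congr fun t => and_congr_left fun _ => ?_
    rw [Fin.rev_surjective.forall]
    simp only [Fin.rev_lt_rev]
  | and e e' ih ih' =>
    rw [revTL, firstTL, TL.sat_and, TL.sat_and]
    exact and_congr ih ih'
  | or e e' ih ih' => exact or_congr ih ih'
  | neg e ih => exact not_congr ih

theorem sat_sparse_given_last_iff (e : CExpr E) {n : ℕ} (M : Fin (n + 1) → State E) :
    e.sparse.given.Sat M (Fin.last n) ↔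
      ∃ b ∈ e.conditions, M (Fin.last n) ∈ b ∨ ∀ i, M i ∉ b := by
  simp [sparse, TL.sat_bigOr, TL.Sat, TL.sat_once, TL.sat_ofEvent, Fin.le_last]

theorem eventually_mem_prefixModels_firstTL_iff (e : CExpr E) (w : ℕ → State E) :
    ∀ᶠ n in atTop, (w ∈ e.firstTL.prefixModels n ↔ w ∈ e.ps) := by
  induction e with
  | simple a b =>
    simp only [mem_ps_simple]
    filter_upwards [eventually_exists_le_iff fun j => (∀ i < j, w i ∉ b) ∧ w j ∈ b ∩ a] with n hn
    rw [← hn, TL.prefixModels, Set.mem_ofPred_eq, sat_firstTL_simple]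
    simp only [Fin.exists_iff, Fin.forall_iff, Fin.le_last, true_and, Fin.lt_def, Nat.lt_succ_iff]
    refine exists_congr fun j => exists_prop.trans (and_congr_right fun hj => ?_)
    exact and_congr_left fun _ =>
      ⟨fun h i hi => h i (hi.le.trans hj) hi, fun h i _ hi => h i hi⟩
  | and e e' ih ih' =>
    filter_upwards [ih, ih'] with n h h'
    exact (TL.sat_and ..).trans (and_congr h h')
  | or e e' ih ih' =>
    filter_upwards [ih, ih'] with n h h'
    exact or_congr h h'
  | neg e ih =>
    filter_upwards [ih] with n h
    exact not_congr h

theorem eventually_reversal_mem_prefixModels_revTL_iff (e : CExpr E) (w : ℕ → State E) :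
    ∀ᶠ n in atTop, ((fun i => w (reversal n i)) ∈ e.revTL.prefixModels n ↔ w ∈ e.ps) := by
  filter_upwards [e.eventually_mem_prefixModels_firstTL_iff w] with n hn
  rw [← hn, TL.reversal_mem_prefixModels, sat_revTL_last_iff_sat_firstTL_rev]
  simp only [Fin.rev_rev]
  rfl

theorem eventually_reversal_mem_prefixModels_sparse_given_iff (e : CExpr E) (w : ℕ → State E) :
    ∀ᶠ n in atTop,
      ((fun i => w (reversal n i)) ∈ e.sparse.given.prefixModels n ↔ w ∈ e.decided) := by
  have hoccurs : ∀ᶠ n in atTop, ∀ b ∈ {b | b ∈ e.conditions},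
      ((∃ i ≤ n, w i ∈ b) ↔ ∃ i, w i ∈ b) :=
    (eventually_all_finite (List.finite_toSet _)).2 fun b _ => eventually_exists_le_iff _
  filter_upwards [hoccurs] with n hn
  rw [TL.reversal_mem_prefixModels, sat_sparse_given_last_iff]
  refine exists_congr fun b => and_congr_right fun hb => or_congr (by simp) ?_
  rw [← Fin.rev_surjective.forall (p := fun i : Fin (n + 1) => w i ∉ b), ← not_exists, ← not_exists,
    ← hn b hb]
  simp only [Fin.exists_iff, Nat.lt_succ_iff, exists_prop]

end Formulas

theorem measurableSet_ps [Finite E] (e : CExpr E) : MeasurableSet e.ps := by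
  cases nonempty_fintype E
  exact measurableSet_of_tendsto_indicator atTop e.firstTL.measurableSet_prefixModels
    e.eventually_mem_prefixModels_firstTL_iff

section Decided

variable (P : Measure (State E)) [IsProbabilityMeasure P] {e : CExpr E}

theorem decided_ae_eq_univ {b : Set (State E)} (hb : b ∈ e.conditions) (h0 : P b = 0) :
    e.decided =ᵐ[seqMeasure P] Set.univ :=
  eventuallyEq_univ.2 <| (infinitePi_ae_forall_notMem P h0).mono fun _ hw => ⟨b, hb, .inr hw⟩

variable [Finite E]

theorem decided_ae_eq_of_forall_ne_zero (h : ∀ b ∈ e.conditions, P b ≠ 0) :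
    e.decided =ᵐ[seqMeasure P] {w | w 0 ∈ ⋃ b ∈ e.conditions, b} := by
  have hoccurs : ∀ᵐ w ∂seqMeasure P, ∀ b ∈ {b | b ∈ e.conditions}, ∃ i, w i ∈ b :=
    (ae_ball_iff (Set.to_countable _)).2 fun b hb =>
      infinitePi_ae_exists_mem P .of_discrete (h b hb)
  filter_upwards [hoccurs] with w hw
  have hmem : w ∈ e.decided ↔ w 0 ∈ ⋃ b ∈ e.conditions, b := by
    simp only [decided, Set.mem_ofPred_eq, Set.mem_iUnion₂, exists_prop]
    refine exists_congr fun b => and_congr_right fun hb => or_iff_left ?_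
    exact not_forall_not.2 (hw b hb)
  exact propext hmem

theorem measureReal_decided_of_forall_ne_zero (h : ∀ b ∈ e.conditions, P b ≠ 0) :
    (seqMeasure P).real e.decided = P.real (⋃ b ∈ e.conditions, b) := by
  rw [measureReal_congr (decided_ae_eq_of_forall_ne_zero P h)]
  exact (measurePreserving_eval_infinitePi (fun _ : ℕ => P) 0).measureReal_preimage
    MeasurableSet.of_discrete.nullMeasurableSet

theorem measureReal_decided_ne_zero : (seqMeasure P).real e.decided ≠ 0 := by
  by_cases h : ∀ b ∈ e.conditions, P b ≠ 0
  · obtain ⟨b, hb⟩ := List.exists_mem_of_ne_nil _ e.conditions_ne_nil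
    rw [measureReal_decided_of_forall_ne_zero P h, measureReal_ne_zero_iff (measure_ne_top _ _)]
    exact fun h0 => h b hb (measure_mono_null (Set.subset_biUnion_of_mem (u := id) hb) h0)
  · push Not at h
    obtain ⟨b, hb, h0⟩ := h
    simp [measureReal_congr (decided_ae_eq_univ P hb h0)]

variable (e)

theorem indepSet_ps_head_mem_conditions :
    IndepSet e.ps {w | w 0 ∈ ⋃ b ∈ e.conditions, b} (seqMeasure P) :=
  indepSet_infinitePi_of_mem_iff_tail P .of_discrete e.measurableSet_ps fun _ hw =>
    mem_ps_iff_tail fun _ hb hwb => hw (Set.mem_biUnion hb hwb)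

theorem measureReal_ps_inter_decided :
    (seqMeasure P).real (e.ps ∩ e.decided) =
      (seqMeasure P).real e.ps * (seqMeasure P).real e.decided := by
  by_cases h : ∀ b ∈ e.conditions, P b ≠ 0
  · have hhead := decided_ae_eq_of_forall_ne_zero P h
    rw [measureReal_congr hhead, measureReal_congr ((ae_eq_refl e.ps).inter hhead)]
    simp only [measureReal_def, (e.indepSet_ps_head_mem_conditions P).measure_inter_eq_mul,
      ENNReal.toReal_mul]
  · push Not at h
    obtain ⟨b, hb, h0⟩ := h
    have huniv := decided_ae_eq_univ P hb h0
    rw [measureReal_congr huniv, measureReal_congr ((ae_eq_refl e.ps).inter huniv)]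
    simp

end Decided

variable [Fintype E] (P : Measure (State E)) [IsProbabilityMeasure P] (e : CExpr E)

theorem hasAsympProb_sparse : HasAsympProb P e.sparse.obj (prPS P e) := by
  have hlim := hasAsympProb_of_eventually_mem_iff (measurePreserving_reversal P)
    e.eventually_reversal_mem_prefixModels_sparse_given_iff
    e.eventually_reversal_mem_prefixModels_revTL_iff (measureReal_decided_ne_zero P)
  rwa [measureReal_ps_inter_decided,
    mul_div_cancel_right₀ _ (measureReal_decided_ne_zero P)] at hlim

theorem hasAsympProb_first : HasAsympProb P e.first.obj (prPS P e) := by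
  have hlim := hasAsympProb_of_eventually_mem_iff (c := e.first) (D := Set.univ)
    (fun _ => MeasurePreserving.id (seqMeasure P))
    (fun _ => .of_forall fun _ => Iff.rfl) e.eventually_mem_prefixModels_firstTL_iff (by simp)
  rwa [Set.inter_univ, probReal_univ, div_one] at hlim

theorem tendsto_probAt_sparse_undef (h : ∀ b ∈ e.conditions, P b ≠ 0) :
    Tendsto (fun n => probAt P e.sparse.obj n Three.undef) atTop
      (𝓝 (1 - P.real (⋃ b ∈ e.conditions, b))) := by
  rw [← measureReal_decided_of_forall_ne_zero P h]
  exact tendsto_probAt_undef (measurePreserving_reversal P)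
    e.eventually_reversal_mem_prefixModels_sparse_given_iff

end CExpr

theorem exists_isProbabilityMeasure_eq_half {α : Type*} [MeasurableSpace α] {s : Set α}
    (hs : MeasurableSet s) (hne : s.Nonempty) (hcompl : sᶜ.Nonempty) :
    ∃ μ : Measure α, IsProbabilityMeasure μ ∧ μ s = 2⁻¹ := by
  obtain ⟨x, hx⟩ := hne
  obtain ⟨y, hy⟩ := hcompl
  refine ⟨(2⁻¹ : ENNReal) • (Measure.dirac x + Measure.dirac y), ⟨?_⟩, ?_⟩
  · simp [ENNReal.inv_two_add_inv_two]
  · simp_all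

theorem exists_tendsto_probAt_sparse_undef_pos [Fintype E] [Nonempty E] :
    ∃ (P : Measure (State E)) (_ : IsProbabilityMeasure P) (e : CExpr E) (q : ℝ), 0 < q ∧
      Tendsto (fun n => probAt P e.sparse.obj n Three.undef) atTop (𝓝 q) := by
  obtain ⟨x⟩ := ‹Nonempty E›
  obtain ⟨P, hP, hx⟩ := exists_isProbabilityMeasure_eq_half (s := basic x) .of_discrete
    ⟨fun _ => true, rfl⟩ ⟨fun _ => false, Bool.false_ne_true⟩
  have hlim := (CExpr.simple (basic x) (basic x)).tendsto_probAt_sparse_undef P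
    (by simp [CExpr.conditions, hx])
  refine ⟨P, hP, _, _, ?_, hlim⟩
  simp only [CExpr.conditions, List.mem_singleton, Set.iUnion_iUnion_eq_left, measureReal_def, hx]
  norm_num

theorem ps_simple_empty (b : Set (State E)) : (CExpr.simple ∅ b).ps = ∅ := by
  simp [CExpr.ps]

theorem TLTL.sat_given_iff_of_obj_eq {c c' : TLTL E} (h : c.obj = c'.obj) {n : ℕ}
    (M : Fin (n + 1) → State E) :
    c.given.Sat M (Fin.last n) ↔ c'.given.Sat M (Fin.last n) := by
  have hM := congrFun h ⟨n, M⟩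
  simp only [obj] at hM
  split_ifs at hM <;> simp_all

theorem sparse_obj_simple_basic_ne [Fintype E] {a b : E} (hab : a ≠ b) (c d : Set (State E)) :
    (CExpr.simple c (basic a)).sparse.obj ≠ (CExpr.simple d (basic b)).sparse.obj := by
  classical
  intro h
  have hiff := TLTL.sat_given_iff_of_obj_eq h ![fun _ => true, fun x => decide (x = a)]
  rw [CExpr.sat_sparse_given_last_iff, CExpr.sat_sparse_given_last_iff] at hiff
  simp [CExpr.conditions, basic, Fin.forall_fin_two, hab.symm] at hiff

end CondTL

theorem mainTheorem3 {E : Type*} [Fintype E] :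
    -- asymptotic probabilities of the sparse reverse interpretation and of the first embedding
    (∀ (P : Measure (CondTL.State E)) [IsProbabilityMeasure P] (e : CondTL.CExpr E),
      CondTL.HasAsympProb P e.sparse.obj (CondTL.prPS P e) ∧
      CondTL.HasAsympProb P e.first.obj (CondTL.prPS P e)) ∧
    -- the asymptotic probability of being undefined
    (∀ (P : Measure (CondTL.State E)) [IsProbabilityMeasure P] (e : CondTL.CExpr E),
      (∀ b ∈ e.conditions, 0 < P b) →
      Tendsto (fun n => CondTL.probAt P e.sparse.obj n CondTL.Three.undef) atTop
        (𝓝 (1 - P.real (⋃ b ∈ e.conditions, b)))) ∧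
    -- it is positive for some expressions and probability assignments
    (Nonempty E → ∃ (P : Measure (CondTL.State E)) (_ : IsProbabilityMeasure P)
      (e : CondTL.CExpr E) (q : ℝ), 0 < q ∧
      Tendsto (fun n => CondTL.probAt P e.sparse.obj n CondTL.Three.undef) atTop (𝓝 q)) ∧
    -- the interpretation is not an embedding
    (∀ a b : E, a ≠ b →
      (CondTL.CExpr.simple ∅ (CondTL.basic a)).ps = (CondTL.CExpr.simple ∅ (CondTL.basic b)).ps ∧
      (CondTL.CExpr.simple ∅ (CondTL.basic a)).sparse.obj ≠
        (CondTL.CExpr.simple ∅ (CondTL.basic b)).sparse.obj) := by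
  refine ⟨fun P _ e => ⟨e.hasAsympProb_sparse P, e.hasAsympProb_first P⟩,
    fun P _ e h => e.tendsto_probAt_sparse_undef P fun b hb => (h b hb).ne',
    fun _ => CondTL.exists_tendsto_probAt_sparse_undef_pos,
    fun a b hab => ⟨?_, CondTL.sparse_obj_simple_basic_ne hab ∅ ∅⟩⟩
  rw [CondTL.ps_simple_empty, CondTL.ps_simple_empty]
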